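/- Let $\mathcal H(m)$ denote the space of Hermitian operators in $\mathbb C^m$. Let $n\ge 0$. An *index* is a non-empty sequence $A=(a_1\ge\dots\ge a_l)$ of naturals with $a_l\ge 2$ and $\sum a_i\le n$; put $\#A=l$, $\delta(A)=n-\sum a_i$, and call $\sum (a_i-1)$ its *complexity*. Let $\Gamma_A(n)$ be the space of unordered collections $\gamma=\{\gamma_1,\dots,\gamma_l\}$ of pairwise orthogonal subspaces of $\mathbb C^n$ of dimensions $a_1,\dots,a_l$, with the quotient topology from ordered collections, which form a subspace of a product of Grassmannians; $\gamma^\perp$ is the orthogonal complement of the span of all the $\gamma_i$. A point $\gamma\in\Gamma_A(n)$ is *subordinate* to $\gamma'\in\Gamma_{A'}(n)$ if every subspace forming $\gamma$ lies in some subspace forming $\gamma'$. A simplex of the join of all the spaces $\Gamma_A(n)$ is *coherent* if any two of its vertices are comparable under subordination; $\Xi(n)$ is the union of all coherent simplices, $\Xi(\gamma)\subset\Xi(n)$ the union of those all of whose vertices are subordinate to $\gamma$, $\partial\Xi(\gamma)$ the union of the simplices of $\Xi(\gamma)$ that do not contain the vertex $\gamma$, and $\breve\Xi(\gamma)=\Xi(\gamma)\setminus\partial\Xi(\gamma)$.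 Let $\chi(\gamma)\subset\mathcal H(n)$ be the set of Hermitian operators for which every $\gamma_i$ is contained in an eigenspace, and let $\sigma_p(n)\subset\mathcal H(n)\times\Xi(n)$ be the union of the sets $\chi(\gamma)\times\Xi(\gamma)$ over all $\gamma\in\Gamma_A(n)$ and all indices $A$ of complexity $\le p$. **Proposition.** For every $p\ge 1$, the space $\sigma_p(n)\setminus\sigma_{p-1}(n)$ is the topological disjoint union, over all indices $A$ of complexity exactly $p$, of subspaces $\beta_A$ that are open in it, each being the total space of a (locally trivial) fibre bundle $\pi_A:\beta_A\to\Gamma_A(n)$, whose fibre over $\gamma$ is $\pi_A^{-1}(\gamma)=\chi(\gamma)\times\breve\Xi(\gamma)\cong\mathbb R^{\#A}\times\mathcal H(\delta(A))\times\breve\Xi(\gamma)$. More precisely, for all $\gamma_0,\gamma_1\in\Gamma_A(n)$ there is a local trivialization of $\pi_A$ over a neighbourhood of $\gamma_1$ with model fibre $\mathbb R^{\#A}\times\mathcal H(\delta(A))\times\breve\Xi(\gamma_0)$, which over each point $\gamma$ of that neighbourhood has the form $$(\Lambda,x)\mapsto\bigl(\gamma,\ (\lambda_1,\dots,\lambda_{\#A}),\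 w^{-1}\circ\Lambda|_{\gamma^\perp}\circ w,\ g(x)\bigr).$$ Here $\lambda_i$ is the eigenvalue of $\Lambda$ on the $i$-th subspace of $\gamma$ in some ordering (with the $i$-th subspace of dimension $a_i$), $w:\mathbb C^{\delta(A)}\to\gamma^\perp$ is a unitary isomorphism, and $g:\breve\Xi(\gamma)\to\breve\Xi(\gamma_0)$ is a homeomorphism; the ordering, $w$ and $g$ depend only on the trivialization and on $\gamma$. -/

import Mathlib

noncomputable section

namespace HermitianResolution

/-- `ℂⁿ` with its standard Hermitian scalar product. -/
abbrev E (n : ℕ) : Type := EuclideanSpace ℂ (Fin n)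

/-- The space of Hermitian operators in `ℂⁿ`, with the (norm) topology. -/
abbrev Herm (n : ℕ) : Type := ↥(selfAdjoint (E n →L[ℂ] E n))

/-! ### Joins of finitely many topological spaces -/

section Join

variable {ι : Type} [Fintype ι] (X : ι → Type)

/-- Two pairs (barycentric coordinates, choice of vertices) define the same point of the join
iff the coordinates agree and the vertices with non-zero coordinates agree. -/
def joinSetoid : Setoid (stdSimplex ℝ ι × (∀ i, X i)) where
  r p q := p.1 = q.1 ∧ ∀ i, (p.1 : ι → ℝ) i ≠ 0 → p.2 i = q.2 i
  iseqv :=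
    { refl := fun _ => ⟨rfl, fun _ _ => rfl⟩
      symm := fun {p q} h => ⟨h.1.symm, fun i hi => (h.2 i (by rw [h.1]; exact hi)).symm⟩
      trans := fun {p q r} h k =>
        ⟨h.1.trans k.1, fun i hi => (h.2 i hi).trans (k.2 i (by rw [← h.1]; exact hi))⟩ }

/-- The join of a finite family of (non-empty) spaces: the quotient of
`(standard simplex) × ∏ X i`, in which the `i`-th component is forgotten where the `i`-th
barycentric coordinate vanishes. -/
def Join : Type := Quotient (joinSetoid X)

instance [∀ i, TopologicalSpace (X i)] : TopologicalSpace (Join X) :=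
  inferInstanceAs (TopologicalSpace (Quotient (joinSetoid X)))

variable {X}

/-- The vertices of the (unique) open simplex of the join containing a given point. -/
def Join.vertices (x : Join X) : Set (Σ i, X i) :=
  Quotient.lift (s := joinSetoid X)
    (fun p => {v : Σ i, X i | (p.1 : ι → ℝ) v.1 ≠ 0 ∧ p.2 v.1 = v.2})
    (fun p q h => by
      ext ⟨i, y⟩
      constructor
      · rintro ⟨h1, h2⟩
        exact ⟨by rw [← h.1]; exact h1, (h.2 i h1).symm.trans h2⟩
      · rintro ⟨h1, h2⟩
        have h1' : (p.1 : ι → ℝ) i ≠ 0 := by rw [h.1]; exact h1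
        exact ⟨h1', (h.2 i h1').trans h2⟩) x

end Join

/-! ### Indices -/

/-- Indices `A = (a₁ ≥ ⋯ ≥ a_l)`, `l ≥ 1`, of naturals `a_i ≥ 2` with `∑ a_i ≤ n`. -/
def Index (n : ℕ) : Type :=
  {A : List ℕ // A ≠ [] ∧ A.Pairwise (· ≥ ·) ∧ (∀ a ∈ A, 2 ≤ a) ∧ A.sum ≤ n}

namespace Index

variable {n : ℕ}

/-- The length `#A`. -/
def length (A : Index n) : ℕ := A.1.length

/-- The `i`-th element `a_i`. -/
def part (A : Index n) (i : Fin A.length) : ℕ := A.1.get i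

/-- The complexity `∑ (a_i - 1)`. -/
def complexity (A : Index n) : ℕ := ∑ i, (A.part i - 1)

/-- The liberty `δ(A) = n - ∑ a_i`. -/
def liberty (A : Index n) : ℕ := n - ∑ i, A.part i

instance : Finite (Index n) := by
  have key : {l : List ℕ | l.length ≤ n ∧ ∀ a ∈ l, a ≤ n}.Finite := by
    refine ((List.finite_length_le (Fin (n + 1)) n).image (List.map Fin.val)).subset ?_
    rintro l ⟨h1, h2⟩
    refine ⟨l.map (Fin.ofNat (n + 1)), by simpa using h1, ?_⟩
    rw [List.map_map]
    conv_rhs => rw [← List.map_id l]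
    refine List.map_congr_left fun a ha => ?_
    simpa using Nat.mod_eq_of_lt (Nat.lt_succ_of_le (h2 a ha))
  refine (key.subset ?_ : {A : List ℕ | A ≠ [] ∧ A.Pairwise (· ≥ ·) ∧
    (∀ a ∈ A, 2 ≤ a) ∧ A.sum ≤ n}.Finite).to_subtype
  rintro l ⟨-, -, h, hs⟩
  refine ⟨?_, fun a ha => (List.single_le_sum (by simp) a ha).trans hs⟩
  have : l.length • 1 ≤ l.sum := List.card_nsmul_le_sum l 1 fun a ha => by have := h a ha; omega
  simpa using this.trans hs

instance : Fintype (Index n) := Fintype.ofFinite _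

end Index

/-! ### The spaces `Γ_A(n)` -/

/-- Ordered collections of pairwise orthogonal subspaces of `ℂⁿ` of dimensions `a₁, …, a_l`. -/
def OrderedConfig {n : ℕ} (A : Index n) : Type :=
  {V : Fin A.length → Submodule ℂ (E n) //
    (∀ i, Module.finrank ℂ (V i) = A.part i) ∧ Pairwise fun i j => V i ⟂ V j}

/-- The topology of a subspace of a product of Grassmannians; a subspace of `ℂⁿ` is identified
with the orthogonal projection onto it. -/
instance {n : ℕ} (A : Index n) : TopologicalSpace (OrderedConfig A) :=
  TopologicalSpace.induced
    (fun V => (fun i => (V.1 i).starProjection : Fin A.length → (E n →L[ℂ] E n))) inferInstance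

/-- Two ordered collections are equivalent if they differ by a permutation of the members. -/
def configSetoid {n : ℕ} (A : Index n) : Setoid (OrderedConfig A) where
  r V W := ∃ s : Equiv.Perm (Fin A.length), ∀ i, W.1 i = V.1 (s i)
  iseqv :=
    { refl := fun _ => ⟨1, fun _ => rfl⟩
      symm := fun {V W} ⟨s, hs⟩ => ⟨s⁻¹, fun i => by simp [hs]⟩
      trans := fun {V W U} ⟨s, hs⟩ ⟨t, ht⟩ => ⟨t.trans s, fun i => by simp [hs, ht]⟩ }

/-- The space `Γ_A(n)` of unordered collections of pairwise orthogonal subspaces of `ℂⁿ` of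
dimensions `a₁, …, a_l`, with the quotient topology. -/
def Gam {n : ℕ} (A : Index n) : Type := Quotient (configSetoid A)

instance {n : ℕ} (A : Index n) : TopologicalSpace (Gam A) :=
  inferInstanceAs (TopologicalSpace (Quotient (configSetoid A)))

section

variable {n : ℕ} {A : Index n}

/-- The unordered collection underlying an ordered one. -/
def Gam.mk (V : OrderedConfig A) : Gam A := Quotient.mk (configSetoid A) V

/-- The set of subspaces forming the point `γ`. -/
def Gam.members (γ : Gam A) : Set (Submodule ℂ (E n)) :=
  Quotient.lift (s := configSetoid A) (fun V => Set.range V.1)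
    (fun V W ⟨s, hs⟩ => by
      have : W.1 = V.1 ∘ s := funext hs
      simp only [this, EquivLike.range_comp]) γ

/-- The orthogonal complement `γ^⊥` of the linear span of all subspaces forming `γ`. -/
def Gam.perp (γ : Gam A) : Submodule ℂ (E n) := (sSup γ.members)ᗮ

/-- `χ(γ)`: the Hermitian operators for which each of the subspaces forming `γ` is contained in
an eigenspace. -/
def chi (γ : Gam A) : Set (Herm n) :=
  {L | ∀ V ∈ γ.members, ∃ c : ℂ,
    V ≤ Module.End.eigenspace ((L : E n →L[ℂ] E n) : E n →ₗ[ℂ] E n) c}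

end

/-- Points of the disjoint union of all spaces `Γ_A(n)`. -/
abbrev Point (n : ℕ) : Type := Σ A : Index n, Gam A

/-- The point `v` is subordinate to the point `w`: every subspace forming `v` is contained in
some subspace forming `w`. -/
def Subordinate {n : ℕ} (v w : Point n) : Prop :=
  ∀ V ∈ v.2.members, ∃ W ∈ w.2.members, V ≤ W

/-! ### The order complex and its subcomplexes -/

/-- The join of the spaces `Γ_A(n)` over all indices `A`. -/
abbrev GamJoin (n : ℕ) : Type := Join (fun A : Index n => Gam A)

/-- The order complex `Ξ(n)`: the union of all coherent simplices of the join, i.e. of those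
all whose vertices are pairwise incident. -/
def Xi (n : ℕ) : Set (GamJoin n) :=
  {x | ∀ v ∈ x.vertices, ∀ w ∈ x.vertices, Subordinate v w ∨ Subordinate w v}

section

variable {n : ℕ} {A : Index n}

/-- `Ξ(γ)`: the union of all coherent simplices all whose vertices are subordinate to `γ`. -/
def XiOf (γ : Gam A) : Set (GamJoin n) :=
  {x | x ∈ Xi n ∧ ∀ v ∈ x.vertices, Subordinate v ⟨A, γ⟩}

/-- The link `∂Ξ(γ)`: the union of all simplices of `Ξ(γ)` that do not contain the vertex `γ`. -/
def linkXi (γ : Gam A) : Set (GamJoin n) :=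
  {x | x ∈ XiOf γ ∧ (⟨A, γ⟩ : Point n) ∉ x.vertices}

/-- The open cone `Ξ(γ) ∖ ∂Ξ(γ)`. -/
def openXi (γ : Gam A) : Set (GamJoin n) := XiOf γ \ linkXi γ

end

/-! ### The conical resolution and its filtration -/

/-- The term `σ_p(n)` of the standard filtration: the union of `χ(γ) × Ξ(γ)` over all points
`γ ∈ Γ_A(n)`, where `A` is an index of complexity at most `p`. -/
def sigma (n p : ℕ) : Set (Herm n × GamJoin n) :=
  ⋃ (A : Index n) (_ : A.complexity ≤ p) (γ : Gam A), chi γ ×ˢ XiOf γ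

end HermitianResolution

end

open HermitianResolution

/-!
The strata of the filtration split according to the greatest vertex. The vertices of a point `x` of
`Ξ(n)` form a finite chain under subordination, so there is a unique `γ`, the greatest vertex, with
`x ∈ Ξ(γ) ∖ ∂Ξ(γ)`. Distinct comparable configurations differ in complexity
(`Subordinate.complexity_le`, `Subordinate.eq_of_complexity_eq`), and passing from a
configuration to a subordinate one enlarges `χ`. Hence `σ_p` is the
disjoint union of the sets `χ(γ) × (Ξ(γ) ∖ ∂Ξ(γ))` over all `γ` of complexity at most `p`
(`mem_sigma_iff_mem_stratum`), and `β_A` collects those with index `A`. In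
`σ_p ∖ σ_{p-1}` the set `β_A` is cut out by the condition that the `A`-th barycentric coordinate
does not vanish; the projection of `β_A` is the `A`-th vertex, which is continuous where that
coordinate is non-zero.

Local triviality comes from the unitary group `U(n)`, which acts on configurations, on the join, and
by conjugation on Hermitian operators, compatibly with `χ` and with the open cones. Being compact,
it acts jointly continuously on the join although the latter is only a quotient space. If `s` is a
continuous family of unitary operators with `s(γ) γ₀ = γ` for `γ` near `γ₁`
(`Gam.exists_unitary_section`), then `(Λ, x) ↦ (γ, s(γ)⁻¹ Λ s(γ), s(γ)⁻¹ x)` identifies the part of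
`β_A` near `γ₁` with a product having the factors `χ(γ₀)` and `Ξ(γ₀) ∖ ∂Ξ(γ₀)`, and `χ(γ₀)` is
parametrized by the eigenvalues on the members of `γ₀` and the restriction to the orthogonal
complement (`exists_homeomorph_chi`).

The family `s` is found in two steps. Orderings of the members of a configuration can be chosen
continuously near `γ₁`, because the projections onto distinct members are at distance at least `1`
(`Gam.exists_local_section`). For ordered configurations, an orthonormal basis adapted to the one
at `γ₁` is projected to the members of the variable one and orthonormalized by the Gram–Schmidt
process (`OrderedConfig.exists_unitary_section`).
-/

noncomputable section

namespace HermitianResolution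

/-! ### Subordination and complexity -/

theorem sum_finrank_eq_finrank_iSup_of_isOrtho {F : Type*} [NormedAddCommGroup F]
    [InnerProductSpace ℂ F] [FiniteDimensional ℂ F] {ι : Type*} {V : ι → Submodule ℂ F}
    (hV : Pairwise fun i j => V i ⟂ V j) (s : Finset ι) :
    ∑ i ∈ s, Module.finrank ℂ (V i) = Module.finrank ℂ ↥(⨆ i ∈ s, V i) := by
  classical
  induction s using Finset.induction_on with
  | empty =>
    rw [Finset.sum_empty, eq_comm, Submodule.finrank_eq_zero]
    simp
  | insert a s ha ih =>
    have hort : V a ⟂ ⨆ i ∈ s, V i := by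
      simp only [Submodule.isOrtho_iSup_right]
      intro i hi
      exact hV (by rintro rfl; exact ha hi)
    have h := Submodule.finrank_sup_add_finrank_inf_eq (V a) (⨆ i ∈ s, V i)
    rw [hort.disjoint.eq_bot, finrank_bot, add_zero] at h
    rw [Finset.sum_insert ha, ih, Finset.iSup_insert, h]

theorem sum_finrank_le_of_isOrtho {F : Type*} [NormedAddCommGroup F] [InnerProductSpace ℂ F]
    [FiniteDimensional ℂ F] {ι : Type*} {V : ι → Submodule ℂ F}
    (hV : Pairwise fun i j => V i ⟂ V j) (s : Finset ι) {W : Submodule ℂ F}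
    (hW : ∀ i ∈ s, V i ≤ W) : ∑ i ∈ s, Module.finrank ℂ (V i) ≤ Module.finrank ℂ W := by
  rw [sum_finrank_eq_finrank_iSup_of_isOrtho hV]
  exact Submodule.finrank_mono (iSup₂_le hW)

section

variable {n : ℕ} {A B : Index n}

theorem Gam.exists_mk_eq (γ : Gam A) : ∃ V, Gam.mk V = γ := Quotient.exists_rep γ

theorem Gam.mk_eq_mk {V W : OrderedConfig A} :
    Gam.mk V = Gam.mk W ↔ ∃ s : Equiv.Perm (Fin A.length), ∀ i, W.1 i = V.1 (s i) :=
  Quotient.eq (r := configSetoid A)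

theorem Index.two_le_part (A : Index n) (i : Fin A.length) : 2 ≤ A.part i :=
  A.2.2.2.1 _ (List.get_mem _ _)

theorem Index.sum_part (A : Index n) : ∑ i, A.part i = A.1.sum := by
  rw [← List.sum_ofFn]
  exact congrArg List.sum (List.ofFn_get A.1)

theorem Index.sum_part_le (A : Index n) : ∑ i, A.part i ≤ n := A.sum_part ▸ A.2.2.2.2

/-- As the parts of an index are listed in decreasing order, they determine it. -/
theorem Index.eq_of_equiv (f : Fin A.length ≃ Fin B.length) (hf : ∀ i, A.part i = B.part (f i)) :
    A = B := by
  have key : ∀ C : Index n, (C.1 : Multiset ℕ) = Finset.univ.val.map C.part := fun C => by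
    rw [Fin.univ_val_map C.part]
    exact congrArg Multiset.ofList (List.ofFn_get C.1).symm
  refine Subtype.ext ((Multiset.coe_eq_coe.1 ?_).eq_of_pairwise' A.2.2.1 B.2.2.1)
  rw [key A, key B, show A.part = B.part ∘ f from funext hf, ← Multiset.map_map B.part f]
  congr 1
  exact congrArg Finset.val (Finset.map_univ_equiv f)

/-- A member of a collection contained in a member of `W` takes up dimension there, so that the
complexity cannot drop; it is preserved only if each member of `W` contains exactly one member
of `V` and coincides with it. -/
theorem complexity_le_of_forall_le (V : OrderedConfig A) (W : OrderedConfig B)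
    (f : Fin A.length → Fin B.length) (hf : ∀ i, V.1 i ≤ W.1 (f i)) :
    A.complexity ≤ B.complexity ∧
      (A.complexity = B.complexity → Function.Bijective f ∧ ∀ i, V.1 i = W.1 (f i)) := by
  classical
  -- the members of `V` inside the `j`-th member of `W` are orthogonal, so their dimensions add up
  have hdim : ∀ j, ∑ i with f i = j, A.part i ≤ B.part j := fun j => by
    rw [← W.2.1 j, Finset.sum_congr rfl fun i _ => (V.2.1 i).symm]
    refine sum_finrank_le_of_isOrtho V.2.2 _ fun i hi => ?_
    rw [← (Finset.mem_filter.1 hi).2]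
    exact hf i
  have hsplit : ∀ j, ∑ i with f i = j, (A.part i - 1) + (Finset.univ.filter (f · = j)).card
      = ∑ i with f i = j, A.part i := fun j => by
    rw [Finset.card_eq_sum_ones, ← Finset.sum_add_distrib]
    exact Finset.sum_congr rfl fun i _ => by have := A.two_le_part i; omega
  -- a fibre with `k ≥ 1` elements contributes at most `b_j - k`; an empty one contributes `0`
  have hle : ∀ j ∈ Finset.univ, ∑ i with f i = j, (A.part i - 1) ≤ B.part j - 1 := fun j _ => by
    have h1 := hdim j
    have h2 := hsplit j
    rcases (Finset.univ.filter (f · = j)).eq_empty_or_nonempty with h | h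
    · simp [h]
    · have := h.card_pos
      omega
  have hA : A.complexity = ∑ j, ∑ i with f i = j, (A.part i - 1) :=
    (Finset.sum_fiberwise _ _ _).symm
  refine ⟨hA ▸ Finset.sum_le_sum hle, fun heq => ?_⟩
  have heq' := (Finset.sum_eq_sum_iff_of_le hle).1 (hA.symm.trans heq)
  -- equality forces `k = 1`, the fibre being non-empty because `b_j - 1` is positive
  have hcard : ∀ j, (Finset.univ.filter (f · = j)).card = 1 := fun j => by
    have h1 := hdim j
    have h2 := hsplit j
    have h3 := heq' j (Finset.mem_univ _)
    have h4 := B.two_le_part j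
    have h5 : (Finset.univ.filter (f · = j)).card ≠ 0 := fun h0 => by
      rw [Finset.card_eq_zero.1 h0] at h3
      simp at h3
      omega
    omega
  refine ⟨⟨fun i i' hii => ?_, fun j => ?_⟩, fun i => ?_⟩
  · exact Finset.card_le_one.1 (hcard (f i')).le i (by simpa using hii) i' (by simp)
  · obtain ⟨i, hi⟩ := Finset.card_pos.1 ((hcard j).symm ▸ one_pos)
    exact ⟨i, (Finset.mem_filter.1 hi).2⟩
  · refine Submodule.eq_of_le_of_finrank_le (hf i) ?_
    rw [W.2.1, V.2.1]
    have h2 := hsplit (f i)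
    have h3 := heq' (f i) (Finset.mem_univ _)
    obtain ⟨k, hk⟩ := Finset.card_eq_one.1 (hcard (f i))
    have hik : i ∈ Finset.univ.filter (f · = f i) := by simp
    obtain rfl : i = k := by simpa [hk] using hik
    rw [hk, Finset.sum_singleton] at h3
    have := B.two_le_part (f i)
    have := A.two_le_part i
    omega

theorem Gam.exists_forall_le {V : OrderedConfig A} {W : OrderedConfig B}
    (h : Subordinate ⟨A, Gam.mk V⟩ ⟨B, Gam.mk W⟩) :
    ∃ f : Fin A.length → Fin B.length, ∀ i, V.1 i ≤ W.1 (f i) := by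
  have h' : ∀ i, ∃ j, V.1 i ≤ W.1 j := fun i => by
    obtain ⟨_, ⟨j, rfl⟩, hj⟩ := h _ ⟨i, rfl⟩
    exact ⟨j, hj⟩
  exact ⟨_, fun i => (h' i).choose_spec⟩

theorem Subordinate.complexity_le {v w : Point n} (h : Subordinate v w) :
    v.1.complexity ≤ w.1.complexity := by
  obtain ⟨A, γ⟩ := v
  obtain ⟨B, δ⟩ := w
  obtain ⟨V, rfl⟩ := γ.exists_mk_eq
  obtain ⟨W, rfl⟩ := δ.exists_mk_eq
  obtain ⟨f, hf⟩ := Gam.exists_forall_le h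
  exact (complexity_le_of_forall_le V W f hf).1

theorem Subordinate.eq_of_complexity_eq {v w : Point n} (h : Subordinate v w)
    (hc : v.1.complexity = w.1.complexity) : v = w := by
  obtain ⟨A, γ⟩ := v
  obtain ⟨B, δ⟩ := w
  obtain ⟨V, rfl⟩ := γ.exists_mk_eq
  obtain ⟨W, rfl⟩ := δ.exists_mk_eq
  obtain ⟨f, hf⟩ := Gam.exists_forall_le h
  obtain ⟨hbij, hVW⟩ := (complexity_le_of_forall_le V W f hf).2 hc
  obtain rfl : A = B := Index.eq_of_equiv (.ofBijective f hbij) fun i => by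
    rw [← V.2.1, hVW, W.2.1]; rfl
  rw [Gam.mk_eq_mk.2 ⟨(Equiv.ofBijective f hbij).symm, fun i => ?_⟩]
  rw [hVW]
  exact congrArg W.1 ((Equiv.ofBijective f hbij).apply_symm_apply i).symm

theorem Subordinate.refl (v : Point n) : Subordinate v v := fun V hV => ⟨V, hV, le_rfl⟩

theorem Subordinate.antisymm {v w : Point n} (h : Subordinate v w) (k : Subordinate w v) : v = w :=
  h.eq_of_complexity_eq (h.complexity_le.antisymm k.complexity_le)

theorem chi_subset_chi {γ : Gam A} {δ : Gam B} (h : Subordinate ⟨A, γ⟩ ⟨B, δ⟩) :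
    chi δ ⊆ chi γ := fun L hL V hV => by
  obtain ⟨W, hW, hVW⟩ := h V hV
  obtain ⟨c, hc⟩ := hL W hW
  exact ⟨c, hVW.trans hc⟩

end

/-! ### Barycentric coordinates and vertices in a join -/

section Join

open Topology

variable {ι : Type} [Fintype ι] {X : ι → Type}

/-- The point of the join with given barycentric coordinates and vertices. -/
def Join.mk (p : stdSimplex ℝ ι × (∀ i, X i)) : Join X := Quotient.mk (joinSetoid X) p

theorem Join.exists_mk_eq (x : Join X) : ∃ p, Join.mk p = x := Quotient.exists_rep x

theorem Join.isQuotientMap_mk [∀ i, TopologicalSpace (X i)] :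
    IsQuotientMap (Join.mk : _ → Join X) := isQuotientMap_quotient_mk'

/-- The `i`-th barycentric coordinate of a point of the join. -/
def Join.coord (i : ι) (x : Join X) : ℝ :=
  Quotient.lift (s := joinSetoid X) (fun p => (p.1 : ι → ℝ) i) (fun _ _ h => by rw [h.1]) x

theorem Join.mem_vertices_mk {p : stdSimplex ℝ ι × (∀ i, X i)} {v : Σ i, X i} :
    v ∈ (Join.mk p).vertices ↔ (p.1 : ι → ℝ) v.1 ≠ 0 ∧ p.2 v.1 = v.2 := Iff.rfl

theorem Join.continuous_coord [∀ i, TopologicalSpace (X i)] (i : ι) :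
    Continuous (Join.coord i : Join X → ℝ) :=
  Join.isQuotientMap_mk.continuous_iff.2
    ((continuous_apply i).comp (continuous_subtype_val.comp continuous_fst))

theorem Join.coord_ne_zero_of_mem_vertices {x : Join X} {v : Σ i, X i} (h : v ∈ x.vertices) :
    x.coord v.1 ≠ 0 := by
  obtain ⟨p, rfl⟩ := x.exists_mk_eq
  exact h.1

theorem Join.exists_mem_vertices {i : ι} {x : Join X} (h : x.coord i ≠ 0) :
    ∃ y, (⟨i, y⟩ : Σ i, X i) ∈ x.vertices := by
  obtain ⟨p, rfl⟩ := x.exists_mk_eq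
  exact ⟨p.2 i, h, rfl⟩

theorem Join.eq_of_mem_vertices {i : ι} {x : Join X} {y z : X i}
    (hy : (⟨i, y⟩ : Σ i, X i) ∈ x.vertices) (hz : (⟨i, z⟩ : Σ i, X i) ∈ x.vertices) : y = z := by
  obtain ⟨p, rfl⟩ := x.exists_mk_eq
  exact hy.2.symm.trans hz.2

theorem Join.vertices_nonempty (x : Join X) : x.vertices.Nonempty := by
  obtain ⟨p, rfl⟩ := x.exists_mk_eq
  by_contra! h
  have h0 : ∀ i, (p.1 : ι → ℝ) i = 0 := fun i => by
    by_contra hi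
    have : (⟨i, p.2 i⟩ : Σ i, X i) ∈ (Join.mk p).vertices := ⟨hi, rfl⟩
    simp [h] at this
  have h1 : ∑ i, (p.1 : ι → ℝ) i = 1 := p.1.2.2
  simp [h0] at h1

theorem Join.finite_vertices (x : Join X) : x.vertices.Finite := by
  obtain ⟨p, rfl⟩ := x.exists_mk_eq
  refine (Set.finite_range fun i => (⟨i, p.2 i⟩ : Σ i, X i)).subset ?_
  rintro ⟨i, y⟩ ⟨-, h⟩
  exact ⟨i, congrArg (Sigma.mk i) h⟩

/-- The vertex with index `i` of a point whose `i`-th barycentric coordinate does not vanish. -/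
def Join.vertex (i : ι) (x : {x : Join X // x.coord i ≠ 0}) : X i :=
  (Join.exists_mem_vertices x.2).choose

theorem Join.vertex_mem (i : ι) (x : {x : Join X // x.coord i ≠ 0}) :
    (⟨i, Join.vertex i x⟩ : Σ i, X i) ∈ x.1.vertices :=
  (Join.exists_mem_vertices x.2).choose_spec

theorem Join.continuous_vertex [∀ i, TopologicalSpace (X i)] (i : ι) :
    Continuous (Join.vertex i : {x : Join X // x.coord i ≠ 0} → X i) := by
  have ho : IsOpen {x : Join X | x.coord i ≠ 0} :=
    isOpen_ne_fun (Join.continuous_coord i) continuous_const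
  refine (Join.isQuotientMap_mk.restrictPreimage_isOpen ho).continuous_iff.2 ?_
  have : Continuous fun p : Join.mk ⁻¹' {x : Join X | x.coord i ≠ 0} => p.1.2 i := by fun_prop
  refine this.congr fun p => ?_
  exact Join.eq_of_mem_vertices (Join.mem_vertices_mk.2 ⟨p.2, rfl⟩)
    (Join.vertex_mem i ⟨Join.mk p.1, p.2⟩)

/-! ### Group actions on joins -/

section Action

variable {G : Type*} [Group G] [∀ i, MulAction G (X i)]

/-- A group acting on every vertex space acts on the join, keeping the barycentric coordinates. -/
instance : MulAction G (Join X) where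
  smul g := Quotient.map (sa := joinSetoid X) (sb := joinSetoid X) (fun p => (p.1, g • p.2))
    fun _ _ h => ⟨h.1, fun i hi => congrArg (g • ·) (h.2 i hi)⟩
  one_smul x := by
    obtain ⟨p, rfl⟩ := x.exists_mk_eq
    exact congrArg Join.mk (Prod.ext rfl (one_smul G p.2))
  mul_smul g h x := by
    obtain ⟨p, rfl⟩ := x.exists_mk_eq
    exact congrArg Join.mk (Prod.ext rfl (mul_smul g h p.2))

theorem Join.smul_mem_vertices_smul (g : G) {x : Join X} {i : ι} {y : X i} :
    (⟨i, g • y⟩ : Σ i, X i) ∈ (g • x).vertices ↔ (⟨i, y⟩ : Σ i, X i) ∈ x.vertices := by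
  obtain ⟨p, rfl⟩ := x.exists_mk_eq
  exact and_congr_right fun _ => smul_left_cancel_iff g

/-- For a locally compact group the product of the group with the quotient map onto the join
is again a quotient map, which makes the action jointly continuous. -/
instance [TopologicalSpace G] [LocallyCompactSpace G] [∀ i, TopologicalSpace (X i)]
    [∀ i, ContinuousSMul G (X i)] : ContinuousSMul G (Join X) where
  continuous_smul := by
    refine Join.isQuotientMap_mk.continuous_lift_prod_right ?_
    refine Join.isQuotientMap_mk.continuous.comp
      (f := fun p : G × stdSimplex ℝ ι × (∀ i, X i) => (p.2.1, p.1 • p.2.2)) ?_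
    fun_prop

end Action

end Join

/-! ### The action of the unitary group -/

/-- The unitary group of `ℂⁿ`, with the norm topology. -/
abbrev UnitaryGp (n : ℕ) : Type := ↥(unitary (E n →L[ℂ] E n))

/-- Taking adjoints is continuous for the topology carried by the space of operators as such, which
instance search does not identify with the one defined by the norm. -/
instance (n : ℕ) : ContinuousStar (E n →L[ℂ] E n) :=
  ⟨(ContinuousLinearMap.adjoint (𝕜 := ℂ) (E := E n) (F := E n)).continuous⟩

instance (n : ℕ) : CompactSpace (UnitaryGp n) := by
  have : ProperSpace (E n →L[ℂ] E n) := FiniteDimensional.proper ℂ _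
  refine isCompact_iff_compactSpace.1 (Metric.isCompact_of_isClosed_isBounded isClosed_unitary ?_)
  refine (Metric.isBounded_closedBall (x := 0) (r := 1)).subset fun u hu => ?_
  rw [mem_closedBall_zero_iff]
  exact ContinuousLinearMap.opNorm_le_bound _ zero_le_one fun x => by
    rw [ContinuousLinearMap.norm_map_of_mem_unitary hu, one_mul]

section

variable {n : ℕ} {A B : Index n}

/-- The image of a subspace under a unitary operator. -/
def rotate (u : UnitaryGp n) (V : Submodule ℂ (E n)) : Submodule ℂ (E n) :=
  V.map ((Unitary.linearIsometryEquiv u).toLinearEquiv : E n →ₗ[ℂ] E n)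

theorem mem_rotate {u : UnitaryGp n} {V : Submodule ℂ (E n)} {x : E n} :
    x ∈ rotate u V ↔ ∃ y ∈ V, (u : E n →L[ℂ] E n) y = x := Iff.rfl

theorem rotate_one (V : Submodule ℂ (E n)) : rotate 1 V = V := by
  ext x; simp [mem_rotate]

theorem rotate_mul (u v : UnitaryGp n) (V : Submodule ℂ (E n)) :
    rotate (u * v) V = rotate u (rotate v V) := by
  ext x; simp [mem_rotate]

theorem starProjection_rotate (u : UnitaryGp n) (V : Submodule ℂ (E n)) :
    (rotate u V).starProjection
      = (u : E n →L[ℂ] E n) * V.starProjection * star (u : E n →L[ℂ] E n) :=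
  ContinuousLinearMap.ext fun x =>
    Submodule.starProjection_map_apply (Unitary.linearIsometryEquiv u) V x

theorem finrank_rotate (u : UnitaryGp n) (V : Submodule ℂ (E n)) :
    Module.finrank ℂ (rotate u V) = Module.finrank ℂ V :=
  LinearEquiv.finrank_map_eq (Unitary.linearIsometryEquiv u).toLinearEquiv V

theorem isOrtho_rotate (u : UnitaryGp n) {V W : Submodule ℂ (E n)} (h : V ⟂ W) :
    rotate u V ⟂ rotate u W :=
  h.map (Unitary.linearIsometryEquiv u).toLinearIsometry

theorem rotate_le_rotate {u : UnitaryGp n} {V W : Submodule ℂ (E n)} :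
    rotate u V ≤ rotate u W ↔ V ≤ W :=
  Submodule.map_le_map_iff_of_injective (Unitary.linearIsometryEquiv u).injective V W

/-! ### Ordered and unordered configurations -/

instance : MulAction (UnitaryGp n) (OrderedConfig A) where
  smul u V := ⟨fun i => rotate u (V.1 i), fun i => (finrank_rotate u _).trans (V.2.1 i),
    fun _ _ hij => isOrtho_rotate u (V.2.2 hij)⟩
  one_smul V := Subtype.ext (funext fun i => rotate_one (V.1 i))
  mul_smul u v V := Subtype.ext (funext fun i => rotate_mul u v (V.1 i))

theorem OrderedConfig.isInducing_starProjection :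
    Topology.IsInducing fun (V : OrderedConfig A) i => (V.1 i).starProjection := ⟨rfl⟩

theorem OrderedConfig.continuous_starProjection (i : Fin A.length) :
    Continuous fun V : OrderedConfig A => (V.1 i).starProjection :=
  (continuous_apply i).comp OrderedConfig.isInducing_starProjection.continuous

instance : ContinuousSMul (UnitaryGp n) (OrderedConfig A) where
  continuous_smul := by
    refine OrderedConfig.isInducing_starProjection.continuous_iff.2 (continuous_pi fun i => ?_)
    have h := (OrderedConfig.continuous_starProjection (A := A) i)
    have : Continuous fun p : UnitaryGp n × OrderedConfig A =>
        (p.1 : E n →L[ℂ] E n) * (p.2.1 i).starProjection * star (p.1 : E n →L[ℂ] E n) :=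
      ((continuous_subtype_val.comp continuous_fst).mul (h.comp continuous_snd)).mul
        (continuous_subtype_val.comp continuous_fst).star
    exact this.congr fun p => (starProjection_rotate _ _).symm

theorem Gam.isQuotientMap_mk : Topology.IsQuotientMap (Gam.mk : OrderedConfig A → Gam A) :=
  isQuotientMap_quotient_mk'

instance : MulAction (UnitaryGp n) (Gam A) where
  smul u := Quotient.map (sa := configSetoid A) (sb := configSetoid A) (u • ·)
    fun _ _ ⟨s, hs⟩ => ⟨s, fun i => congrArg (rotate u) (hs i)⟩
  one_smul γ := by
    obtain ⟨V, rfl⟩ := γ.exists_mk_eq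
    exact congrArg Gam.mk (one_smul _ V)
  mul_smul u v γ := by
    obtain ⟨V, rfl⟩ := γ.exists_mk_eq
    exact congrArg Gam.mk (mul_smul u v V)

theorem Gam.smul_mk (u : UnitaryGp n) (V : OrderedConfig A) : u • Gam.mk V = Gam.mk (u • V) := rfl

instance : ContinuousSMul (UnitaryGp n) (Gam A) where
  continuous_smul := Gam.isQuotientMap_mk.continuous_lift_prod_right
    (Gam.isQuotientMap_mk.continuous.comp continuous_smul)

theorem Gam.members_smul (u : UnitaryGp n) (γ : Gam A) :
    (u • γ).members = rotate u '' γ.members := by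
  obtain ⟨V, rfl⟩ := γ.exists_mk_eq
  exact Set.range_comp (rotate u) V.1

theorem subordinate_smul_iff (u : UnitaryGp n) {γ : Gam A} {δ : Gam B} :
    Subordinate ⟨A, u • γ⟩ ⟨B, u • δ⟩ ↔ Subordinate ⟨A, γ⟩ ⟨B, δ⟩ := by
  simp [Subordinate, Gam.members_smul, rotate_le_rotate]

/-! ### The order complex -/

theorem smul_mem_Xi (u : UnitaryGp n) {x : GamJoin n} (hx : x ∈ Xi n) : u • x ∈ Xi n := by
  rintro ⟨B, δ⟩ hv ⟨C, ε⟩ hw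
  obtain ⟨δ, rfl⟩ := MulAction.surjective u δ
  obtain ⟨ε, rfl⟩ := MulAction.surjective u ε
  rw [subordinate_smul_iff, subordinate_smul_iff]
  exact hx _ ((Join.smul_mem_vertices_smul u).1 hv) _ ((Join.smul_mem_vertices_smul u).1 hw)

theorem mem_openXi {γ : Gam A} {x : GamJoin n} :
    x ∈ openXi γ ↔ x ∈ XiOf γ ∧ (⟨A, γ⟩ : Point n) ∈ x.vertices := by
  simp only [openXi, linkXi, Set.mem_sdiff, Set.mem_ofPred_eq]
  tauto

theorem smul_mem_openXi_smul (u : UnitaryGp n) {γ : Gam A} {x : GamJoin n} (hx : x ∈ openXi γ) :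
    u • x ∈ openXi (u • γ) := by
  rw [mem_openXi] at hx ⊢
  refine ⟨⟨smul_mem_Xi u hx.1.1, ?_⟩, (Join.smul_mem_vertices_smul u).2 hx.2⟩
  rintro ⟨B, δ⟩ hv
  obtain ⟨δ, rfl⟩ := MulAction.surjective u δ
  rw [subordinate_smul_iff]
  exact hx.1.2 _ ((Join.smul_mem_vertices_smul u).1 hv)

theorem smul_mem_openXi_iff (u : UnitaryGp n) {γ : Gam A} {x : GamJoin n} :
    u • x ∈ openXi (u • γ) ↔ x ∈ openXi γ :=
  ⟨fun h => by simpa using smul_mem_openXi_smul u⁻¹ h, smul_mem_openXi_smul u⟩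

/-! ### Hermitian operators -/

/-- Conjugation of a Hermitian operator by a unitary one. -/
def conj (u : UnitaryGp n) (L : Herm n) : Herm n :=
  ⟨(u : E n →L[ℂ] E n) * L * star (u : E n →L[ℂ] E n), L.2.conjugate _⟩

theorem conj_apply (u : UnitaryGp n) (L : Herm n) (x : E n) :
    (conj u L : E n →L[ℂ] E n) x
      = (u : E n →L[ℂ] E n) ((L : E n →L[ℂ] E n) (star (u : E n →L[ℂ] E n) x)) := rfl

theorem star_apply_apply (u : UnitaryGp n) (x : E n) :
    star (u : E n →L[ℂ] E n) ((u : E n →L[ℂ] E n) x) = x :=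
  congr($(Unitary.coe_star_mul_self u) x)

theorem apply_star_apply (u : UnitaryGp n) (x : E n) :
    (u : E n →L[ℂ] E n) (star (u : E n →L[ℂ] E n) x) = x :=
  congr($(Unitary.coe_mul_star_self u) x)

theorem conj_apply_apply (u : UnitaryGp n) (L : Herm n) (x : E n) :
    (conj u L : E n →L[ℂ] E n) ((u : E n →L[ℂ] E n) x)
      = (u : E n →L[ℂ] E n) ((L : E n →L[ℂ] E n) x) := by
  rw [conj_apply, star_apply_apply]

theorem conj_inv_apply (u : UnitaryGp n) (L : Herm n) (x : E n) :
    (u : E n →L[ℂ] E n) ((conj u⁻¹ L : E n →L[ℂ] E n) x)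
      = (L : E n →L[ℂ] E n) ((u : E n →L[ℂ] E n) x) := by
  rw [conj_apply, ← Unitary.star_eq_inv, Unitary.coe_star, star_star, apply_star_apply]

theorem conj_conj_inv (u : UnitaryGp n) (L : Herm n) : conj u (conj u⁻¹ L) = L := by
  refine Subtype.ext (ContinuousLinearMap.ext fun x => ?_)
  rw [conj_apply, conj_inv_apply, apply_star_apply]

theorem conj_inv_conj (u : UnitaryGp n) (L : Herm n) : conj u⁻¹ (conj u L) = L := by
  simpa using conj_conj_inv u⁻¹ L

theorem continuous_conj : Continuous fun p : UnitaryGp n × Herm n => conj p.1 p.2 := by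
  have h1 : Continuous fun p : UnitaryGp n × Herm n => (p.1 : E n →L[ℂ] E n) :=
    continuous_subtype_val.comp continuous_fst
  exact ((h1.mul (continuous_subtype_val.comp continuous_snd)).mul h1.star).subtype_mk _

theorem conj_mem_chi_smul (u : UnitaryGp n) {γ : Gam A} {L : Herm n} (hL : L ∈ chi γ) :
    conj u L ∈ chi (u • γ) := by
  intro W hW
  rw [Gam.members_smul] at hW
  obtain ⟨V, hV, rfl⟩ := hW
  obtain ⟨c, hc⟩ := hL V hV
  refine ⟨c, fun x hx => ?_⟩
  obtain ⟨y, hy, rfl⟩ := mem_rotate.1 hx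
  have := Module.End.mem_eigenspace_iff.1 (hc hy)
  rw [Module.End.mem_eigenspace_iff]
  refine (conj_apply_apply u L y).trans ?_
  rw [← map_smul]
  exact congrArg _ this

theorem conj_inv_mem_chi (u : UnitaryGp n) {γ : Gam A} {L : Herm n} (hL : L ∈ chi (u • γ)) :
    conj u⁻¹ L ∈ chi γ := by
  simpa using conj_mem_chi_smul u⁻¹ hL

end

/-! ### Local sections of the quotient map onto unordered configurations -/

section

variable {n : ℕ} {A : Index n}

/-- Reordering of the members by a permutation that preserves the dimensions. -/
def OrderedConfig.reorder (s : Equiv.Perm (Fin A.length)) (hs : ∀ i, A.part (s i) = A.part i)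
    (V : OrderedConfig A) : OrderedConfig A :=
  ⟨fun i => V.1 (s i), fun i => (V.2.1 _).trans (hs i), fun _ _ h => V.2.2 (s.injective.ne h)⟩

theorem OrderedConfig.continuous_reorder (s : Equiv.Perm (Fin A.length))
    (hs : ∀ i, A.part (s i) = A.part i) : Continuous (OrderedConfig.reorder s hs) :=
  OrderedConfig.isInducing_starProjection.continuous_iff.2
    (continuous_pi fun i => OrderedConfig.continuous_starProjection (s i))

/-- The saturation of an open set is the union of its images under the finitely many permutations
of the members that preserve their dimensions. -/
theorem Gam.isOpenMap_mk : IsOpenMap (Gam.mk : OrderedConfig A → Gam A) := by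
  intro O hO
  rw [← Gam.isQuotientMap_mk.isOpen_preimage]
  have : Gam.mk ⁻¹' (Gam.mk '' O) = ⋃ s : Equiv.Perm (Fin A.length),
      ⋃ hs : ∀ i, A.part (s i) = A.part i, OrderedConfig.reorder s hs ⁻¹' O := by
    ext V
    simp only [Set.mem_preimage, Set.mem_image, Set.mem_iUnion]
    constructor
    · rintro ⟨W, hW, hWV⟩
      obtain ⟨s, hs⟩ := Gam.mk_eq_mk.1 hWV.symm
      refine ⟨s, fun i => by rw [← W.2.1 i, ← V.2.1 (s i), hs], ?_⟩
      rwa [show OrderedConfig.reorder s _ V = W from Subtype.ext (funext fun i => (hs i).symm)]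
    · rintro ⟨s, hs, h⟩
      exact ⟨_, h, (Gam.mk_eq_mk.2 ⟨s, fun _ => rfl⟩).symm⟩
  rw [this]
  exact isOpen_iUnion fun s => isOpen_iUnion fun hs =>
    hO.preimage (OrderedConfig.continuous_reorder s hs)

/-- Projections onto distinct members of a configuration are at distance at least `1`. -/
theorem OrderedConfig.one_le_norm_sub (V : OrderedConfig A) {i j : Fin A.length} (hij : i ≠ j) :
    1 ≤ ‖(V.1 i).starProjection - (V.1 j).starProjection‖ := by
  have hpos : 0 < Module.finrank ℂ (V.1 i) := by
    rw [V.2.1]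
    exact two_pos.trans_le (A.two_le_part i)
  obtain ⟨⟨v, hv⟩, hv0⟩ := Module.finrank_pos_iff_exists_ne_zero.1 hpos
  have hv0 : v ≠ 0 := fun h => hv0 (Subtype.ext h)
  have h := ContinuousLinearMap.le_opNorm ((V.1 i).starProjection - (V.1 j).starProjection) v
  rw [sub_apply, Submodule.starProjection_eq_self_iff.2 hv,
    (Submodule.starProjection_apply_eq_zero_iff _).2 (V.2.2 hij hv), sub_zero] at h
  exact (le_mul_iff_one_le_left (norm_pos_iff.2 hv0)).1 h

/-- Near the class of `V₁` the members of an unordered configuration can be ordered continuously: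
the ordering in which they are close to the members of `V₁` is unique. -/
theorem Gam.exists_local_section (V₁ : OrderedConfig A) :
    ∃ (N : Set (Gam A)) (r : Gam A → OrderedConfig A), IsOpen N ∧ Gam.mk V₁ ∈ N ∧
      ContinuousOn r N ∧ r (Gam.mk V₁) = V₁ ∧ ∀ γ ∈ N, Gam.mk (r γ) = γ := by
  -- with radius `1 / 2`, no two orderings of one configuration lie in this neighbourhood
  let O : Set (OrderedConfig A) :=
    {V | ∀ i, ‖(V.1 i).starProjection - (V₁.1 i).starProjection‖ < 1 / 2}
  have hO : IsOpen O := by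
    have : O = ⋂ i, {V | ‖(V.1 i).starProjection - (V₁.1 i).starProjection‖ < 1 / 2} := by
      ext; simp [O]
    rw [this]
    exact isOpen_iInter_of_finite fun i => isOpen_lt
      ((OrderedConfig.continuous_starProjection i).sub continuous_const).norm continuous_const
  have h₁ : V₁ ∈ O := fun i => by simp
  have hinj : Function.Injective fun V : O => Gam.mk V.1 := by
    rintro ⟨V, hV⟩ ⟨W, hW⟩ h
    obtain ⟨s, hs⟩ := Gam.mk_eq_mk.1 h
    have hs1 : ∀ i, s i = i := fun i => by
      by_contra hi
      have h1 := V₁.one_le_norm_sub hi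
      have h2 := hV (s i)
      have h3 := hW i
      rw [hs] at h3
      rw [norm_sub_rev] at h2
      have h4 := norm_sub_le_norm_sub_add_norm_sub (V₁.1 (s i)).starProjection
        (V.1 (s i)).starProjection (V₁.1 i).starProjection
      linarith
    exact Subtype.ext (Subtype.ext (funext fun i => by rw [hs, hs1]))
  have hemb : Topology.IsOpenEmbedding fun V : O => Gam.mk V.1 :=
    .of_continuous_injective_isOpenMap
      (Gam.isQuotientMap_mk.continuous.comp continuous_subtype_val) hinj
      (Gam.isOpenMap_mk.comp hO.isOpenMap_subtype_val)
  have : Nonempty O := ⟨⟨V₁, h₁⟩⟩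
  let e := hemb.toOpenPartialHomeomorph
  have hsymm : ∀ V : O, e.symm (Gam.mk V.1) = V := fun V => e.left_inv (Set.mem_univ V)
  refine ⟨Set.range fun V : O => Gam.mk V.1, fun γ => (e.symm γ).1, hemb.isOpen_range,
    ⟨⟨V₁, h₁⟩, rfl⟩, ?_, congrArg Subtype.val (hsymm ⟨V₁, h₁⟩), ?_⟩
  · refine continuous_subtype_val.comp_continuousOn ?_
    have := e.continuousOn_symm
    rwa [show e.target = Set.range fun V : O => Gam.mk V.1 from
      hemb.toOpenPartialHomeomorph_target _] at this
  · rintro _ ⟨V, rfl⟩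
    exact congrArg (fun W : O => Gam.mk W.1) (hsymm V)

/-! ### Local sections of the unitary action -/

/-- The members of a configuration, indexed by `some i`, together with the orthogonal complement
of their span, indexed by `none`. -/
def OrderedConfig.block (V : OrderedConfig A) : Option (Fin A.length) → Submodule ℂ (E n)
  | none => (⨆ i, V.1 i)ᗮ
  | some i => V.1 i

/-- The dimensions of the blocks of a configuration. -/
def Index.blockDim (A : Index n) : Option (Fin A.length) → ℕ
  | none => A.liberty
  | some i => A.part i

theorem Index.sum_blockDim (A : Index n) : ∑ o, A.blockDim o = n := by
  rw [Fintype.sum_option]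
  exact Nat.sub_add_cancel A.sum_part_le

theorem OrderedConfig.finrank_block (V : OrderedConfig A) (o : Option (Fin A.length)) :
    Module.finrank ℂ (V.block o) = A.blockDim o := by
  cases o with
  | some i => exact V.2.1 i
  | none =>
    have h1 := sum_finrank_eq_finrank_iSup_of_isOrtho V.2.2 Finset.univ
    have h2 := (⨆ i, V.1 i).finrank_add_finrank_orthogonal
    rw [show (⨆ i ∈ Finset.univ, V.1 i) = ⨆ i, V.1 i by simp] at h1
    simp only [V.2.1] at h1
    rw [← h1, finrank_euclideanSpace_fin] at h2
    exact Nat.eq_sub_of_add_eq' h2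

theorem OrderedConfig.isOrtho_block (V : OrderedConfig A) :
    Pairwise fun o o' => V.block o ⟂ V.block o' := by
  have h : ∀ i, V.block none ⟂ V.block (some i) := fun i =>
    (Submodule.isOrtho_orthogonal_left _).mono_right (le_iSup V.1 i)
  rintro (_ | i) (_ | j) hij
  · exact absurd rfl hij
  · exact h j
  · exact (h i).symm
  · exact V.2.2 fun h => hij (congrArg some h)

theorem OrderedConfig.iSup_block (V : OrderedConfig A) : ⨆ o, V.block o = ⊤ := by
  rw [iSup_option]
  exact (sup_comm _ _).trans (Submodule.sup_orthogonal_of_hasOrthogonalProjection)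

theorem OrderedConfig.starProjection_block_none (V : OrderedConfig A) :
    (V.block none).starProjection = 1 - ∑ i, (V.1 i).starProjection := by
  refine ContinuousLinearMap.ext fun x => ?_
  have hx : ((1 : E n →L[ℂ] E n) - ∑ i, (V.1 i).starProjection) x
      = x - ∑ i, (V.1 i).starProjection x := by
    simp
  rw [hx]
  refine Submodule.eq_starProjection_of_mem_orthogonal ?_ ?_
  · refine (Submodule.mem_orthogonal _ _).2 fun y hy => ?_
    induction hy using Submodule.iSup_induction' with
    | zero => simp
    | add y z _ _ hy hz => rw [inner_add_left, hy, hz, add_zero]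
    | mem j y hy =>
      rw [inner_sub_right, inner_sum, Finset.sum_eq_single j, ← inner_sub_right]
      · exact (V.1 j).sub_starProjection_mem_orthogonal x y hy
      · exact fun i _ hij => (V.2.2 hij.symm).inner_eq hy (Submodule.starProjection_apply_mem _ _)
      · simp
  · rw [sub_sub_cancel]
    refine Submodule.le_orthogonal_orthogonal _ (Submodule.sum_mem _ fun i _ => ?_)
    exact le_iSup V.1 i (Submodule.starProjection_apply_mem _ _)

theorem OrderedConfig.continuous_starProjection_block (o : Option (Fin A.length)) :
    Continuous fun V : OrderedConfig A => (V.block o).starProjection := by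
  cases o with
  | some i => exact OrderedConfig.continuous_starProjection i
  | none =>
    simp only [OrderedConfig.starProjection_block_none]
    exact continuous_const.sub
      (continuous_finsetSum _ fun i _ => OrderedConfig.continuous_starProjection i)

/-- A distribution of the numbers `0, …, n - 1` over the blocks, according to their dimensions. -/
def Index.blockEquiv (A : Index n) : Fin n ≃ Σ o, Fin (A.blockDim o) :=
  Fintype.equivOfCardEq (by simp [A.sum_blockDim])

theorem OrderedConfig.exists_orthonormalBasis (V : OrderedConfig A) :
    ∃ b : OrthonormalBasis (Fin n) ℂ (E n), ∀ k, b k ∈ V.block (A.blockEquiv k).1 := by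
  classical
  have hV : OrthogonalFamily ℂ (fun o => V.block o) fun o => (V.block o).subtypeₗᵢ :=
    .of_pairwise V.isOrtho_block
  have hint : DirectSum.IsInternal V.block :=
    hV.isInternal_iff.2 (by rw [V.iSup_block, Submodule.top_orthogonal_eq_bot])
  have b : ∀ o, OrthonormalBasis (Fin (A.blockDim o)) ℂ (V.block o) := fun o =>
    (stdOrthonormalBasis ℂ (V.block o)).reindex (finCongr (V.finrank_block o))
  refine ⟨(hint.collectedOrthonormalBasis hV b).reindex A.blockEquiv.symm, fun k => ?_⟩
  rw [OrthonormalBasis.reindex_apply]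
  exact hint.collectedOrthonormalBasis_mem hV b _

/-! ### Gram–Schmidt orthonormalization -/

open InnerProductSpace

theorem continuousOn_gramSchmidt {F : Type*} [NormedAddCommGroup F] [InnerProductSpace ℂ F]
    (k : Fin n) : ContinuousOn (fun f : Fin n → F => gramSchmidt ℂ f k)
      {f | LinearIndependent ℂ f} := by
  induction k using WellFoundedLT.induction with
  | ind k ih =>
    simp only [gramSchmidt_def ℂ _ k, Submodule.starProjection_singleton]
    refine (continuous_apply k).continuousOn.sub (continuousOn_finsetSum _ fun i hi => ?_)
    have hi := ih i (Finset.mem_Iio.1 hi)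
    refine ((hi.inner (𝕜 := ℂ) (continuous_apply k).continuousOn).div ?_ fun f hf => ?_).smul hi
    · fun_prop
    · simpa using gramSchmidt_ne_zero i hf

theorem continuousOn_gramSchmidtNormed {F : Type*} [NormedAddCommGroup F] [InnerProductSpace ℂ F]
    (k : Fin n) : ContinuousOn (fun f : Fin n → F => gramSchmidtNormed ℂ f k)
      {f | LinearIndependent ℂ f} := by
  have h := continuousOn_gramSchmidt (F := F) k
  refine ContinuousOn.smul (ContinuousOn.inv₀ ?_ fun f hf => ?_) h
  · exact Complex.continuous_ofReal.comp_continuousOn h.norm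
  · simpa using gramSchmidt_ne_zero k hf

/-- Orthogonal blocks do not interact in the Gram–Schmidt process. -/
theorem gramSchmidt_mem_of_isOrtho {F : Type*} [NormedAddCommGroup F] [InnerProductSpace ℂ F]
    {κ : Type*} {K : κ → Submodule ℂ F} (hK : Pairwise fun o o' => K o ⟂ K o') {c : Fin n → κ}
    {f : Fin n → F} (hf : ∀ k, f k ∈ K (c k)) (k : Fin n) : gramSchmidt ℂ f k ∈ K (c k) := by
  induction k using WellFoundedLT.induction with
  | ind k ih =>
    simp only [gramSchmidt_def ℂ _ k, Submodule.starProjection_singleton]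
    refine Submodule.sub_mem _ (hf k) (Submodule.sum_mem _ fun i hi => ?_)
    have hi := ih i (Finset.mem_Iio.1 hi)
    by_cases hc : c i = c k
    · exact Submodule.smul_mem _ _ (hc ▸ hi)
    · rw [(hK hc).inner_eq hi (hf k)]
      simp

/-- Near any configuration `V₁` there is a continuous choice of unitary operators carrying a fixed
configuration `V₀` to the variable one: projecting an orthonormal basis adapted to `V₁` to the
blocks of `V` and orthonormalizing gives a basis adapted to `V`, and the operator carries a basis
adapted to `V₀` to it. -/
theorem OrderedConfig.exists_unitary_section (V₀ V₁ : OrderedConfig A) :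
    ∃ (O : Set (OrderedConfig A)) (s : OrderedConfig A → UnitaryGp n), IsOpen O ∧ V₁ ∈ O ∧
      ContinuousOn s O ∧ ∀ V ∈ O, s V • V₀ = V := by
  obtain ⟨b₀, hb₀⟩ := V₀.exists_orthonormalBasis
  obtain ⟨b₁, hb₁⟩ := V₁.exists_orthonormalBasis
  let f : OrderedConfig A → Fin n → E n := fun V k =>
    (V.block (A.blockEquiv k).1).starProjection (b₁ k)
  have hfc : Continuous f := continuous_pi fun k =>
    (OrderedConfig.continuous_starProjection_block _).clm_apply continuous_const
  have hfmem : ∀ V k, f V k ∈ V.block (A.blockEquiv k).1 := fun V k =>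
    Submodule.starProjection_apply_mem _ _
  let O : Set (OrderedConfig A) := f ⁻¹' {g | LinearIndependent ℂ g}
  -- outside of `O` the basis is completed arbitrarily, which does no harm
  let e : OrderedConfig A → OrthonormalBasis (Fin n) ℂ (E n) := fun V =>
    gramSchmidtOrthonormalBasis (by simp) (f V)
  have he : ∀ V ∈ O, ∀ k, e V k = gramSchmidtNormed ℂ (f V) k := fun V hV k =>
    gramSchmidtOrthonormalBasis_apply _ (norm_ne_zero_iff.1 (by
      rw [gramSchmidtNormed_unit_length k hV]; exact one_ne_zero))
  let s : OrderedConfig A → UnitaryGp n := fun V =>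
    Unitary.linearIsometryEquiv.symm (b₀.equiv (e V) (Equiv.refl _))
  have hs : ∀ V x, (s V : E n →L[ℂ] E n) x = ∑ k, inner ℂ (b₀ k) x • e V k := fun V x => by
    conv_lhs => rw [← b₀.sum_repr' x]
    simp [s]
  refine ⟨O, s, isOpen_setOfPred_linearIndependent.preimage hfc, ?_, ?_, fun V hV => ?_⟩
  · have : f V₁ = b₁ := funext fun k => Submodule.starProjection_eq_self_iff.2 (hb₁ k)
    change LinearIndependent ℂ (f V₁)
    rw [this]
    exact b₁.orthonormal.linearIndependent
  · rw [Topology.IsInducing.subtypeVal.continuousOn_iff]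
    have h : ContinuousOn (fun V => ∑ k, (innerSL ℂ (b₀ k)).smulRight
        (gramSchmidtNormed ℂ (f V) k)) O := by
      refine continuousOn_finsetSum _ fun k _ => ?_
      have := (continuousOn_gramSchmidtNormed k).comp hfc.continuousOn (Set.mapsTo_preimage f _)
      exact (ContinuousLinearMap.smulRightL ℂ (E n) (E n)
        (innerSL ℂ (b₀ k))).continuous.comp_continuousOn this
    refine h.congr fun V hV => ContinuousLinearMap.ext fun x => ?_
    refine (hs V x).trans ?_
    simp [he V hV]
  · refine Subtype.ext (funext fun i => Submodule.eq_of_le_of_finrank_eq ?_ ?_)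
    · rintro _ ⟨x, hx, rfl⟩
      change (s V : E n →L[ℂ] E n) x ∈ _
      rw [hs]
      refine Submodule.sum_mem _ fun k _ => ?_
      by_cases hk : (A.blockEquiv k).1 = some i
      · refine Submodule.smul_mem _ _ ?_
        have := gramSchmidt_mem_of_isOrtho V.isOrtho_block (hfmem V) k
        rw [hk] at this
        rw [he V hV]
        exact Submodule.smul_mem _ _ this
      · rw [(V₀.isOrtho_block hk).inner_eq (hb₀ k) hx, zero_smul]
        exact Submodule.zero_mem _
    · exact ((s V • V₀).2.1 i).trans (V.2.1 i).symm

/-- The unitary group acts transitively on the configurations with a given index, and near each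
of them the acting operator can be chosen continuously. -/
theorem Gam.exists_unitary_section (γ₀ γ₁ : Gam A) :
    ∃ (N : Set (Gam A)) (s : Gam A → UnitaryGp n), IsOpen N ∧ γ₁ ∈ N ∧
      ContinuousOn s N ∧ ∀ γ, s γ • γ₀ = γ := by
  classical
  obtain ⟨V₀, rfl⟩ := γ₀.exists_mk_eq
  have htrans : ∀ γ : Gam A, ∃ u : UnitaryGp n, u • Gam.mk V₀ = γ := fun γ => by
    obtain ⟨V, rfl⟩ := γ.exists_mk_eq
    obtain ⟨O, s, -, hVO, -, hs⟩ := V₀.exists_unitary_section V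
    exact ⟨s V, by rw [Gam.smul_mk, hs V hVO]⟩
  choose t ht using htrans
  obtain ⟨V₁, rfl⟩ := γ₁.exists_mk_eq
  obtain ⟨N, r, hN, hN₁, hr, hr₁, hmk⟩ := Gam.exists_local_section V₁
  obtain ⟨O, s, hO, hO₁, hs, hsV⟩ := V₀.exists_unitary_section V₁
  refine ⟨N ∩ r ⁻¹' O, (N ∩ r ⁻¹' O).piecewise (s ∘ r) t, hr.isOpen_inter_preimage hN hO,
    ⟨hN₁, by rwa [Set.mem_preimage, hr₁]⟩, ?_, fun γ => ?_⟩
  · exact (hs.comp (hr.mono Set.inter_subset_left) fun γ hγ => hγ.2).congr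
      (Set.piecewise_eqOn _ _ _)
  · by_cases hγ : γ ∈ N ∩ r ⁻¹' O
    · rw [Set.piecewise_eq_of_mem _ _ _ hγ, Gam.smul_mk, Function.comp_apply, hsV _ hγ.2,
        hmk γ hγ.1]
    · rw [Set.piecewise_eq_of_notMem _ _ _ hγ, ht]

end

/-! ### Hermitian operators with prescribed eigenspaces -/

section

variable {n : ℕ} {A : Index n}

open ContinuousLinearMap

theorem Gam.perp_mk (V : OrderedConfig A) : (Gam.mk V).perp = V.block none := rfl

theorem Gam.perp_smul (u : UnitaryGp n) (γ : Gam A) : (u • γ).perp = rotate u γ.perp := by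
  rw [Gam.perp, Gam.perp, Gam.members_smul, sSup_image, rotate, Submodule.map_orthogonal_equiv,
    sSup_eq_iSup, Submodule.map_iSup]
  simp only [Submodule.map_iSup]
  rfl

theorem Gam.exists_isometry_range_eq_perp (γ : Gam A) :
    ∃ w : E A.liberty →ₗᵢ[ℂ] E n, LinearMap.range w.toLinearMap = γ.perp := by
  obtain ⟨V, rfl⟩ := γ.exists_mk_eq
  let b : OrthonormalBasis (Fin A.liberty) ℂ (V.block none) :=
    (stdOrthonormalBasis ℂ (V.block none)).reindex (finCongr (V.finrank_block none))
  refine ⟨(V.block none).subtypeₗᵢ.comp b.repr.symm.toLinearIsometry, ?_⟩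
  change LinearMap.range ((V.block none).subtype ∘ₗ
    b.repr.symm.toLinearEquiv.toLinearMap) = _
  rw [LinearMap.range_comp_of_range_eq_top _ (LinearEquiv.range _), Submodule.range_subtype,
    Gam.perp_mk]

theorem Herm.inner_apply_left (L : Herm n) (x y : E n) :
    inner ℂ ((L : E n →L[ℂ] E n) x) y = inner ℂ x ((L : E n →L[ℂ] E n) y) :=
  (isSelfAdjoint_iff_isSymmetric.1 L.2) x y

theorem eigenvalue_eq_re_inner {γ : Gam A} {L : Herm n} (hL : L ∈ chi γ) {V : Submodule ℂ (E n)}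
    (hV : V ∈ γ.members) {a : E n} (ha : a ∈ V) (ha1 : ‖a‖ = 1) {v : E n} (hv : v ∈ V) :
    (L : E n →L[ℂ] E n) v = (((inner ℂ a ((L : E n →L[ℂ] E n) a)).re : ℝ) : ℂ) • v := by
  obtain ⟨c, hc⟩ := hL V hV
  have h : ∀ x ∈ V, (L : E n →L[ℂ] E n) x = c • x := fun x hx =>
    Module.End.mem_eigenspace_iff.1 (hc hx)
  have h1 : inner ℂ a ((L : E n →L[ℂ] E n) a) = c := by
    rw [h a ha, inner_smul_right, inner_self_eq_norm_sq_to_K, ha1]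
    simp
  have h2 : starRingEnd ℂ c = c := by
    rw [← h1, inner_conj_symm, L.inner_apply_left]
  rw [h v hv, h1, Complex.conj_eq_iff_re.1 h2]

/-- A Hermitian operator of `χ(γ)` preserves the orthogonal complement of `γ`. -/
theorem apply_mem_perp {γ : Gam A} {L : Herm n} (hL : L ∈ chi γ) {x : E n} (hx : x ∈ γ.perp) :
    (L : E n →L[ℂ] E n) x ∈ γ.perp := by
  rw [Gam.perp, sSup_eq_iSup', Submodule.mem_orthogonal] at hx ⊢
  intro y hy
  induction hy using Submodule.iSup_induction' with
  | zero => simp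
  | add y z _ _ hy hz => rw [inner_add_left, hy, hz, add_zero]
  | mem V y hy =>
    obtain ⟨c, hc⟩ := hL V V.2
    have h1 : (L : E n →L[ℂ] E n) y = c • y := Module.End.mem_eigenspace_iff.1 (hc hy)
    rw [← L.inner_apply_left, h1, inner_smul_left, hx y (Submodule.mem_iSup_of_mem V hy), mul_zero]

/-- The restriction of an operator to a subspace parametrized by the isometry `w`, followed by the
orthogonal projection to this subspace. -/
def compress {m : ℕ} (w : E m →ₗᵢ[ℂ] E n) (L : Herm n) : Herm m :=
  ⟨adjoint w.toContinuousLinearMap ∘L (L : E n →L[ℂ] E n) ∘L w.toContinuousLinearMap,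
    IsSelfAdjoint.adjoint_conj L.2 w.toContinuousLinearMap⟩

theorem adjoint_apply_apply {m : ℕ} (w : E m →ₗᵢ[ℂ] E n) (u : E m) :
    adjoint w.toContinuousLinearMap (w u) = u := by
  refine ext_inner_left ℂ fun v => ?_
  rw [adjoint_inner_right]
  exact w.inner_map_map v u

theorem apply_compress {γ : Gam A} {L : Herm n} (hL : L ∈ chi γ) {m : ℕ} {w : E m →ₗᵢ[ℂ] E n}
    (hw : LinearMap.range w.toLinearMap = γ.perp) (u : E m) :
    (L : E n →L[ℂ] E n) (w u) = w ((compress w L : E m →L[ℂ] E m) u) := by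
  have h : (L : E n →L[ℂ] E n) (w u) ∈ LinearMap.range w.toLinearMap := by
    rw [hw]
    exact apply_mem_perp hL (hw ▸ ⟨u, rfl⟩)
  obtain ⟨z, hz⟩ := h
  have hz : w z = (L : E n →L[ℂ] E n) (w u) := hz
  change _ = w (adjoint w.toContinuousLinearMap ((L : E n →L[ℂ] E n) (w u)))
  rw [← hz, adjoint_apply_apply]

/-- The Hermitian operator acting as `lam i` on the `i`-th member of a configuration and as `M` on
the orthogonal complement, parametrized by `w`. -/
def assemble {m : ℕ} (V : OrderedConfig A) (w : E m →ₗᵢ[ℂ] E n) (lam : Fin A.length → ℝ)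
    (M : Herm m) : Herm n :=
  ⟨∑ i, (lam i : ℂ) • (V.1 i).starProjection +
    w.toContinuousLinearMap ∘L (M : E m →L[ℂ] E m) ∘L adjoint w.toContinuousLinearMap, by
    refine add_mem (sum_mem fun i _ => ?_) (IsSelfAdjoint.conj_adjoint M.2 _)
    exact IsSelfAdjoint.smul (Complex.conj_ofReal _) (isSelfAdjoint_starProjection _)⟩

theorem assemble_apply {m : ℕ} (V : OrderedConfig A) (w : E m →ₗᵢ[ℂ] E n) (lam : Fin A.length → ℝ)
    (M : Herm m) (x : E n) : (assemble V w lam M : E n →L[ℂ] E n) x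
      = ∑ i, (lam i : ℂ) • (V.1 i).starProjection x
        + w ((M : E m →L[ℂ] E m) (adjoint w.toContinuousLinearMap x)) := by
  simp [assemble]

theorem assemble_apply_mem {m : ℕ} {V : OrderedConfig A} {w : E m →ₗᵢ[ℂ] E n}
    (hw : LinearMap.range w.toLinearMap = (Gam.mk V).perp) (lam : Fin A.length → ℝ) (M : Herm m)
    {i : Fin A.length} {v : E n} (hv : v ∈ V.1 i) :
    (assemble V w lam M : E n →L[ℂ] E n) v = (lam i : ℂ) • v := by
  have h0 : adjoint w.toContinuousLinearMap v = 0 := by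
    refine ext_inner_left ℂ fun u => ?_
    rw [adjoint_inner_right, inner_zero_right]
    have : w u ∈ V.block none := by
      rw [← Gam.perp_mk, ← hw]
      exact ⟨u, rfl⟩
    exact (V.isOrtho_block (Option.some_ne_none i).symm).inner_eq this hv
  rw [assemble_apply, h0, map_zero, map_zero, add_zero, Finset.sum_eq_single i,
    Submodule.starProjection_eq_self_iff.2 hv]
  · intro j _ hij
    rw [(Submodule.starProjection_apply_eq_zero_iff _).2 (V.2.2 hij.symm hv), smul_zero]
  · simp

theorem assemble_apply_isometry {m : ℕ} {V : OrderedConfig A} {w : E m →ₗᵢ[ℂ] E n}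
    (hw : LinearMap.range w.toLinearMap = (Gam.mk V).perp) (lam : Fin A.length → ℝ) (M : Herm m)
    (u : E m) : (assemble V w lam M : E n →L[ℂ] E n) (w u) = w ((M : E m →L[ℂ] E m) u) := by
  have hu : w u ∈ V.block none := by
    rw [← Gam.perp_mk, ← hw]
    exact ⟨u, rfl⟩
  rw [assemble_apply, adjoint_apply_apply, Finset.sum_eq_zero, zero_add]
  intro i _
  have h0 : (V.1 i).starProjection (w u) = 0 := (Submodule.starProjection_apply_eq_zero_iff _).2
    (V.isOrtho_block (Option.some_ne_none i).symm hu)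
  rw [h0, smul_zero]

theorem assemble_mem_chi {m : ℕ} {V : OrderedConfig A} {w : E m →ₗᵢ[ℂ] E n}
    (hw : LinearMap.range w.toLinearMap = (Gam.mk V).perp) (lam : Fin A.length → ℝ) (M : Herm m) :
    assemble V w lam M ∈ chi (Gam.mk V) := by
  rintro _ ⟨i, rfl⟩
  exact ⟨lam i, fun v hv => Module.End.mem_eigenspace_iff.2 (assemble_apply_mem hw lam M hv)⟩

theorem Herm.ext_of_config {m : ℕ} {V : OrderedConfig A} {w : E m →ₗᵢ[ℂ] E n}
    (hw : LinearMap.range w.toLinearMap = (Gam.mk V).perp) {L L' : Herm n}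
    (h : ∀ i, ∀ v ∈ V.1 i, (L : E n →L[ℂ] E n) v = (L' : E n →L[ℂ] E n) v)
    (h' : ∀ u, (L : E n →L[ℂ] E n) (w u) = (L' : E n →L[ℂ] E n) (w u)) : L = L' := by
  refine Subtype.ext (ContinuousLinearMap.ext fun x => ?_)
  have hx : x ∈ ⨆ o, V.block o := V.iSup_block ▸ Submodule.mem_top
  induction hx using Submodule.iSup_induction' with
  | zero => simp
  | add y z _ _ hy hz => rw [map_add, map_add, hy, hz]
  | mem o y hy =>
    cases o with
    | some i => exact h i y hy
    | none =>
      rw [← Gam.perp_mk, ← hw] at hy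
      obtain ⟨u, rfl⟩ := hy
      exact h' u

/-- The space `χ(γ)` is parametrized by the eigenvalues on the members of `γ` and the restriction
to the orthogonal complement. -/
theorem exists_homeomorph_chi (V : OrderedConfig A) {w : E A.liberty →ₗᵢ[ℂ] E n}
    (hw : LinearMap.range w.toLinearMap = (Gam.mk V).perp) :
    ∃ φ : chi (Gam.mk V) ≃ₜ (Fin A.length → ℝ) × Herm A.liberty, ∀ L : chi (Gam.mk V),
      (∀ i, ∀ v ∈ V.1 i, (L.1 : E n →L[ℂ] E n) v = (((φ L).1 i : ℝ) : ℂ) • v) ∧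
      ∀ u, (L.1 : E n →L[ℂ] E n) (w u) = w (((φ L).2 : E A.liberty →L[ℂ] E A.liberty) u) := by
  have hunit : ∀ i, ∃ a ∈ V.1 i, ‖a‖ = 1 := fun i => by
    have hpos : 0 < Module.finrank ℂ (V.1 i) := by
      rw [V.2.1]
      exact two_pos.trans_le (A.two_le_part i)
    have := Module.nontrivial_of_finrank_pos hpos
    obtain ⟨a, ha⟩ := exists_norm_eq (V.1 i) zero_le_one
    exact ⟨a, a.2, ha⟩
  choose a ha ha1 using hunit
  have heig : ∀ L : chi (Gam.mk V), ∀ i, ∀ v ∈ V.1 i, (L.1 : E n →L[ℂ] E n) v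
      = (((inner ℂ (a i) ((L.1 : E n →L[ℂ] E n) (a i))).re : ℝ) : ℂ) • v := fun L i v hv =>
    eigenvalue_eq_re_inner L.2 ⟨i, rfl⟩ (ha i) (ha1 i) hv
  refine ⟨{ toFun := fun L => (fun i => (inner ℂ (a i) ((L.1 : E n →L[ℂ] E n) (a i))).re,
              compress w L.1)
            invFun := fun q => ⟨assemble V w q.1 q.2, assemble_mem_chi hw _ _⟩
            left_inv := fun L => ?_
            right_inv := fun q => ?_
            continuous_toFun := ?_
            continuous_invFun := ?_ }, fun L => ⟨heig L, apply_compress L.2 hw⟩⟩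
  · refine Subtype.ext (Herm.ext_of_config hw (fun i v hv => ?_) fun u => ?_)
    · rw [assemble_apply_mem hw _ _ hv, heig L i v hv]
    · rw [assemble_apply_isometry hw, apply_compress L.2 hw]
  · refine Prod.ext (funext fun i => ?_) (Subtype.ext (ContinuousLinearMap.ext fun u => ?_))
    · simp only
      rw [assemble_apply_mem hw _ _ (ha i), inner_smul_right, inner_self_eq_norm_sq_to_K, ha1]
      simp
    · refine w.injective ?_
      rw [← apply_compress (assemble_mem_chi hw q.1 q.2) hw, assemble_apply_isometry hw]
  · have hval : Continuous fun L : chi (Gam.mk V) => (L.1 : E n →L[ℂ] E n) :=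
      continuous_subtype_val.comp continuous_subtype_val
    refine (continuous_pi fun i => ?_).prodMk (Continuous.subtype_mk ?_ _)
    · exact Complex.continuous_re.comp
        (continuous_const.inner (hval.clm_apply continuous_const))
    · exact continuous_const.clm_comp (hval.clm_comp continuous_const)
  · refine Continuous.subtype_mk (Continuous.subtype_mk (Continuous.add ?_ ?_) _) _
    · exact continuous_finsetSum _ fun i _ =>
        (Complex.continuous_ofReal.comp ((continuous_apply i).comp continuous_fst)).smul
          continuous_const
    · exact continuous_const.clm_comp
        ((continuous_subtype_val.comp continuous_snd).clm_comp continuous_const)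

end

/-! ### The strata of the filtration -/

section

variable {n : ℕ} {A B : Index n}

/-- The union of the products `χ(γ) × (Ξ(γ) ∖ ∂Ξ(γ))` over all `γ ∈ Γ_A(n)`. -/
def stratum (A : Index n) : Set (Herm n × GamJoin n) :=
  {q | ∃ γ : Gam A, q ∈ chi γ ×ˢ openXi γ}

theorem coord_ne_zero_of_mem_openXi {γ : Gam A} {x : GamJoin n} (hx : x ∈ openXi γ) :
    x.coord A ≠ 0 :=
  Join.coord_ne_zero_of_mem_vertices (mem_openXi.1 hx).2

theorem coord_ne_zero_of_mem_stratum {q : Herm n × GamJoin n} (hq : q ∈ stratum A) :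
    q.2.coord A ≠ 0 := by
  obtain ⟨γ, -, hx⟩ := hq
  exact coord_ne_zero_of_mem_openXi hx

/-- The projection of a stratum to the space of configurations, remembering the greatest vertex of
the simplex containing a point of the order complex. -/
def stratumProj (q : stratum A) : Gam A :=
  Join.vertex A ⟨q.1.2, coord_ne_zero_of_mem_stratum q.2⟩

theorem stratumProj_eq {q : stratum A} {γ : Gam A} (h : q.1.2 ∈ openXi γ) : stratumProj q = γ :=
  Join.eq_of_mem_vertices (Join.vertex_mem A ⟨q.1.2, coord_ne_zero_of_mem_stratum q.2⟩)
    (mem_openXi.1 h).2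

theorem mem_chi_stratumProj (q : stratum A) : q.1.1 ∈ chi (stratumProj q) := by
  obtain ⟨γ, hL, hx⟩ := q.2
  rwa [stratumProj_eq hx]

theorem mem_openXi_stratumProj (q : stratum A) : q.1.2 ∈ openXi (stratumProj q) := by
  obtain ⟨γ, hL, hx⟩ := q.2
  rwa [stratumProj_eq hx]

theorem continuous_stratumProj : Continuous (stratumProj : stratum A → Gam A) :=
  (Join.continuous_vertex A).comp
    (Continuous.subtype_mk (continuous_snd.comp continuous_subtype_val) _)

theorem image_preimage_stratumProj (γ : Gam A) :
    Subtype.val '' (stratumProj ⁻¹' {γ} : Set (stratum A)) = chi γ ×ˢ openXi γ := by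
  ext q
  constructor
  · rintro ⟨q, rfl, rfl⟩
    exact ⟨mem_chi_stratumProj q, mem_openXi_stratumProj q⟩
  · intro hq
    exact ⟨⟨q, γ, hq⟩, stratumProj_eq hq.2, rfl⟩

/-- Every point of the order complex lies in an open cone: the vertices of the point form a finite
chain, whose greatest element is its vertex of maximal complexity. -/
theorem exists_mem_openXi {x : GamJoin n} (hx : x ∈ Xi n) :
    ∃ (A : Index n) (γ : Gam A), x ∈ openXi γ := by
  obtain ⟨⟨A, γ⟩, hv, hmax⟩ :=
    x.vertices.exists_max_image (fun v => v.1.complexity) x.finite_vertices x.vertices_nonempty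
  refine ⟨A, γ, mem_openXi.2 ⟨⟨hx, fun w hw => ?_⟩, hv⟩⟩
  rcases hx w hw _ hv with h | h
  · exact h
  · rw [h.eq_of_complexity_eq (h.complexity_le.antisymm (hmax w hw))]
    exact Subordinate.refl w

theorem eq_of_mem_openXi {γ : Gam A} {δ : Gam B} {x : GamJoin n} (hγ : x ∈ openXi γ)
    (hδ : x ∈ openXi δ) : A = B := by
  rw [mem_openXi] at hγ hδ
  exact congrArg Sigma.fst ((hδ.1.2 _ hγ.2).antisymm (hγ.1.2 _ hδ.2))

theorem mem_sigma {p : ℕ} {q : Herm n × GamJoin n} :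
    q ∈ sigma n p ↔ ∃ (A : Index n) (γ : Gam A),
      A.complexity ≤ p ∧ q.1 ∈ chi γ ∧ q.2 ∈ XiOf γ := by
  simp only [sigma, Set.mem_iUnion, Set.mem_prod]
  exact ⟨fun ⟨A, h, γ, hq⟩ => ⟨A, γ, h, hq⟩, fun ⟨A, γ, h, hq⟩ => ⟨A, h, γ, hq⟩⟩

/-- Replacing a configuration by the greatest vertex of `x` enlarges `χ` and does not raise the
complexity, so that `σ_p` is the union of the products with the open cones alone. -/
theorem mem_sigma_iff_mem_stratum {p : ℕ} {q : Herm n × GamJoin n} :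
    q ∈ sigma n p ↔ ∃ A : Index n, A.complexity ≤ p ∧ q ∈ stratum A := by
  rw [mem_sigma]
  constructor
  · rintro ⟨A, γ, hA, hL, hx⟩
    obtain ⟨B, δ, hδ⟩ := exists_mem_openXi hx.1
    have hsub := hx.2 _ (mem_openXi.1 hδ).2
    exact ⟨B, hsub.complexity_le.trans hA, δ, chi_subset_chi hsub hL, hδ⟩
  · rintro ⟨A, hA, γ, hL, hx⟩
    exact ⟨A, γ, hA, hL, (mem_openXi.1 hx).1⟩

theorem mem_sigma_diff_iff {p : ℕ} (hp : 1 ≤ p) {q : Herm n × GamJoin n} :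
    q ∈ sigma n p \ sigma n (p - 1) ↔ ∃ A : Index n, A.complexity = p ∧ q ∈ stratum A := by
  rw [Set.mem_sdiff, mem_sigma_iff_mem_stratum, mem_sigma_iff_mem_stratum]
  constructor
  · rintro ⟨⟨A, hA, hq⟩, h⟩
    refine ⟨A, ?_, hq⟩
    by_contra hne
    exact h ⟨A, by omega, hq⟩
  · rintro ⟨A, hA, hq⟩
    refine ⟨⟨A, hA.le, hq⟩, ?_⟩
    rintro ⟨B, hB, γ', -, hx'⟩
    obtain ⟨γ, -, hx⟩ := hq
    obtain rfl := eq_of_mem_openXi hx hx'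
    omega

/-- Among the points of the stratum of `σ_p`, those over the index `A` are distinguished by the
non-vanishing of the barycentric coordinate at `A`. -/
theorem mem_stratum_iff_coord_ne_zero {q : Herm n × GamJoin n} (hq : q ∈ stratum B)
    (hAB : A.complexity = B.complexity) : q ∈ stratum A ↔ q.2.coord A ≠ 0 := by
  refine ⟨coord_ne_zero_of_mem_stratum, fun h => ?_⟩
  obtain ⟨δ, hL, hx⟩ := hq
  obtain ⟨γ, hγ⟩ := Join.exists_mem_vertices h
  have := ((mem_openXi.1 hx).1.2 _ hγ).eq_of_complexity_eq hAB
  obtain rfl : A = B := congrArg Sigma.fst this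
  exact ⟨δ, hL, hx⟩

/-! ### Local triviality -/

theorem _root_.ContinuousOn.conj {X : Type*} [TopologicalSpace X] {u : X → UnitaryGp n}
    {L : X → Herm n} {S : Set X} (hu : ContinuousOn u S) (hL : ContinuousOn L S) :
    ContinuousOn (fun x => conj (u x) (L x)) S :=
  continuous_conj.comp_continuousOn (hu.prodMk hL)

theorem _root_.ContinuousOn.smul_gamJoin {X : Type*} [TopologicalSpace X] {u : X → UnitaryGp n}
    {f : X → GamJoin n} {S : Set X} (hu : ContinuousOn u S) (hf : ContinuousOn f S) :
    ContinuousOn (fun x => u x • f x) S :=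
  hu.smul hf

/-- Two configurations with the same index have homeomorphic open cones. -/
def openXiHomeomorph (u : UnitaryGp n) {γ₀ γ : Gam A} (h : u • γ₀ = γ) :
    openXi γ ≃ₜ openXi γ₀ :=
  (Homeomorph.smul u⁻¹).subtype fun x => by
    subst h
    rw [← smul_mem_openXi_iff u⁻¹, inv_smul_smul]
    rfl

/-- A family of unitary operators carrying `γ₀` to `γ`, continuous for `γ` in an open set, and
coordinates on `χ(γ₀)` trivialize the stratum over this open set. -/
def stratumTrivialization {F : Type*} [TopologicalSpace F] {γ₀ : Gam A}
    (φ : chi γ₀ ≃ₜ F) {N : Set (Gam A)} (hN : IsOpen N) (s : Gam A → UnitaryGp n)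
    (hs : ContinuousOn s N) (hsγ : ∀ γ, s γ • γ₀ = γ) :
    Bundle.Trivialization (F × openXi γ₀) (stratumProj : stratum A → Gam A) where
  toFun q := (stratumProj q,
    φ ⟨conj (s (stratumProj q))⁻¹ q.1.1,
      conj_inv_mem_chi _ ((hsγ (stratumProj q)).symm ▸ mem_chi_stratumProj q)⟩,
    openXiHomeomorph (s (stratumProj q)) (hsγ _) ⟨q.1.2, mem_openXi_stratumProj q⟩)
  invFun z := ⟨(conj (s z.1) (φ.symm z.2.1).1, s z.1 • z.2.2.1), s z.1 • γ₀,
    conj_mem_chi_smul _ (φ.symm z.2.1).2, smul_mem_openXi_smul _ z.2.2.2⟩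
  source := stratumProj ⁻¹' N
  target := N ×ˢ Set.univ
  map_source' q hq := ⟨hq, trivial⟩
  map_target' z hz := by
    rw [Set.mem_preimage, stratumProj_eq (smul_mem_openXi_smul _ z.2.2.2), hsγ]
    exact hz.1
  left_inv' q _ := by
    refine Subtype.ext (Prod.ext ?_ ?_)
    · simp only [Homeomorph.symm_apply_apply]
      exact conj_conj_inv _ _
    · exact smul_inv_smul _ _
  right_inv' z _ := by
    obtain ⟨γ, f, x⟩ := z
    have h : stratumProj (⟨(conj (s γ) (φ.symm f).1, s γ • x.1), s γ • γ₀,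
        conj_mem_chi_smul _ (φ.symm f).2, smul_mem_openXi_smul _ x.2⟩ : stratum A) = γ := by
      rw [stratumProj_eq (smul_mem_openXi_smul _ x.2), hsγ]
    refine Prod.ext h (Prod.ext ?_ (Subtype.ext ?_))
    · simp only [h, conj_inv_conj]
      exact φ.apply_symm_apply f
    · change (s (stratumProj _))⁻¹ • s γ • x.1 = x.1
      rw [h, inv_smul_smul]
  open_source := hN.preimage continuous_stratumProj
  open_target := hN.prod isOpen_univ
  continuousOn_toFun := by
    have h : ContinuousOn (fun q : stratum A => (s (stratumProj q))⁻¹) (stratumProj ⁻¹' N) :=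
      (hs.comp continuous_stratumProj.continuousOn (Set.mapsTo_preimage _ _)).inv
    have hL := h.conj (L := fun q => q.1.1)
      (continuous_fst.comp continuous_subtype_val).continuousOn
    have hx := h.smul_gamJoin (f := fun q => q.1.2)
      (continuous_snd.comp continuous_subtype_val).continuousOn
    exact continuous_stratumProj.continuousOn.prodMk
      ((φ.continuous.comp_continuousOn
        (Topology.IsInducing.subtypeVal.continuousOn_iff.2 hL)).prodMk
        (Topology.IsInducing.subtypeVal.continuousOn_iff.2 hx))
  continuousOn_invFun := by
    have h : ContinuousOn (fun z : Gam A × F × openXi γ₀ => s z.1) (N ×ˢ Set.univ) :=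
      hs.comp continuous_fst.continuousOn fun z hz => hz.1
    have hL := h.conj (L := fun z => (φ.symm z.2.1).1) (continuous_subtype_val.comp
      (φ.symm.continuous.comp (continuous_fst.comp continuous_snd))).continuousOn
    have hx := h.smul_gamJoin (f := fun z => z.2.2.1)
      (continuous_subtype_val.comp (continuous_snd.comp continuous_snd)).continuousOn
    exact Topology.IsInducing.subtypeVal.continuousOn_iff.2 (hL.prodMk hx)
  baseSet := N
  open_baseSet := hN
  source_eq := rfl
  target_eq := rfl
  proj_toFun _ _ := rfl

theorem stratumTrivialization_apply {F : Type*} [TopologicalSpace F] {γ₀ : Gam A}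
    (φ : chi γ₀ ≃ₜ F) {N : Set (Gam A)} (hN : IsOpen N) (s : Gam A → UnitaryGp n)
    (hs : ContinuousOn s N) (hsγ : ∀ γ, s γ • γ₀ = γ) {q : stratum A} {γ : Gam A}
    (hL : q.1.1 ∈ chi γ) (hx : q.1.2 ∈ openXi γ) :
    stratumTrivialization φ hN s hs hsγ q = (γ,
      φ ⟨conj (s γ)⁻¹ q.1.1, conj_inv_mem_chi _ ((hsγ γ).symm ▸ hL)⟩,
      openXiHomeomorph (s γ) (hsγ γ) ⟨q.1.2, hx⟩) := by
  obtain rfl := stratumProj_eq hx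
  rfl

end

end HermitianResolution

end

open HermitianResolution
theorem mainTheorem8 (n p : ℕ) (hp : 1 ≤ p) :
    ∃ β : {A : Index n // A.complexity = p} → Set (Herm n × GamJoin n),
      -- the stratum is the topological disjoint union of the `β A`
      (⋃ A, β A) = sigma n p \ sigma n (p - 1) ∧
      Pairwise (Function.onFun Disjoint β) ∧
      (∀ A, ∃ U : Set (Herm n × GamJoin n), IsOpen U ∧
        β A = U ∩ (sigma n p \ sigma n (p - 1))) ∧
      -- each `β A` is the total space of a fibre bundle over `Γ_A(n)`
      ∀ A : {A : Index n // A.complexity = p}, ∃ π : β A → Gam A.1,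
        Continuous π ∧
        -- with fibre `χ(γ) × (open cone of γ)` over `γ`
        (∀ γ : Gam A.1, Subtype.val '' (π ⁻¹' {γ}) = chi γ ×ˢ openXi γ) ∧
        -- locally trivial, with model fibre `ℝ^#A × Herm(δ(A)) × (open cone of γ₀)`, any `γ₀`
        ∀ γ₀ γ₁ : Gam A.1,
          ∃ e : Bundle.Trivialization
              ((Fin A.1.length → ℝ) × Herm A.1.liberty × openXi γ₀) π,
            γ₁ ∈ e.baseSet ∧
            -- and fibrewise the product of: the eigenvalues on the members of `γ`, the
            -- restriction to the orthogonal complement of `γ`, and a map of open cones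
            ∀ γ ∈ e.baseSet,
              ∃ (V : OrderedConfig A.1) (w : E A.1.liberty →ₗᵢ[ℂ] E n)
                (g : openXi γ ≃ₜ openXi γ₀),
                Gam.mk V = γ ∧ LinearMap.range w.toLinearMap = γ.perp ∧
                ∀ (L : Herm n) (x : openXi γ) (h : (L, (x : GamJoin n)) ∈ β A),
                  L ∈ chi γ →
                    (∀ i, ∀ v ∈ V.1 i, (L : E n →L[ℂ] E n) v =
                      (((e ⟨(L, x), h⟩).2.1 i : ℝ) : ℂ) • v) ∧
                    (∀ u, (L : E n →L[ℂ] E n) (w u) =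
                      w (((e ⟨(L, x), h⟩).2.2.1 : E A.1.liberty →L[ℂ] E A.1.liberty) u)) ∧
                    (e ⟨(L, x), h⟩).2.2.2 = g x := by
  refine ⟨fun A => stratum A.1, ?_, ?_, ?_, ?_⟩
  · ext q
    rw [Set.mem_iUnion, mem_sigma_diff_iff hp]
    exact ⟨fun ⟨A, h⟩ => ⟨A.1, A.2, h⟩, fun ⟨A, hA, h⟩ => ⟨⟨A, hA⟩, h⟩⟩
  · refine fun A B hAB => Set.disjoint_left.2 ?_
    rintro q ⟨γ, -, hγ⟩ ⟨δ, -, hδ⟩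
    exact hAB (Subtype.ext (eq_of_mem_openXi hγ hδ))
  · refine fun A => ⟨{q | q.2.coord A.1 ≠ 0},
      isOpen_ne_fun ((Join.continuous_coord A.1).comp continuous_snd) continuous_const, ?_⟩
    ext q
    rw [Set.mem_inter_iff, mem_sigma_diff_iff hp]
    refine ⟨fun h => ⟨coord_ne_zero_of_mem_stratum h, A.1, A.2, h⟩, ?_⟩
    rintro ⟨hq, B, hB, h⟩
    exact (mem_stratum_iff_coord_ne_zero h (A.2.trans hB.symm)).2 hq
  intro A
  refine ⟨stratumProj, continuous_stratumProj, image_preimage_stratumProj, fun γ₀ γ₁ => ?_⟩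
  obtain ⟨V₀, rfl⟩ := γ₀.exists_mk_eq
  obtain ⟨w₀, hw₀⟩ := (Gam.mk V₀).exists_isometry_range_eq_perp
  obtain ⟨φ, hφ⟩ := exists_homeomorph_chi V₀ hw₀
  obtain ⟨N, s, hN, hN₁, hs, hsγ⟩ := Gam.exists_unitary_section (Gam.mk V₀) γ₁
  refine ⟨(stratumTrivialization φ hN s hs hsγ).transFiberHomeomorph (Homeomorph.prodAssoc _ _ _),
    hN₁, fun γ _ => ⟨s γ • V₀,
      (Unitary.linearIsometryEquiv (s γ)).toLinearIsometry.comp w₀,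
      openXiHomeomorph (s γ) (hsγ γ), hsγ γ, ?_, fun L x h hL => ?_⟩⟩
  · refine (LinearMap.range_comp w₀.toLinearMap _).trans ?_
    rw [hw₀]
    conv_rhs => rw [← hsγ γ, Gam.perp_smul]
    rfl
  · rw [Bundle.Trivialization.transFiberHomeomorph_apply,
      stratumTrivialization_apply φ hN s hs hsγ (q := ⟨(L, x.1), h⟩) hL x.2]
    have hL' : conj (s γ)⁻¹ L ∈ chi (Gam.mk V₀) := conj_inv_mem_chi _ ((hsγ γ).symm ▸ hL)
    obtain ⟨h1, h2⟩ := hφ ⟨_, hL'⟩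
    refine ⟨?_, fun u => ?_, rfl⟩
    · rintro i _ ⟨y, hy, rfl⟩
      refine (conj_inv_apply _ L y).symm.trans ?_
      rw [h1 i y hy, map_smul]
      rfl
    · refine (conj_inv_apply _ L (w₀ u)).symm.trans ?_
      rw [h2 u]
      rfl
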